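/- **Setting.** Let $\mathcal G$ be a class of directed acyclic graphs (DAGs) on $m$ nodes: $\mathcal G_m$ is the class of all of them, and $\mathcal G_{m,k}$ is the class of those in which every node has at most $k$ parents. All variables $X_1,\dots,X_m$ take values in a common space $\mathcal X$. Fix an exponential family on $\mathcal X$ with densities $\exp(\eta^{T}T(x)-\psi(\eta))\,h(x)$, $\eta\in\mathbb R^d$. A parameter map $\Theta$ assigns to each $G\in\mathcal G$ and each node $i$ a natural parameter $\eta_i=\eta_i(X_{\pi_i(G)},\Theta)$ depending on the values of the parents $\pi_i(G)$ of $i$. It equals $\eta_0=\eta_0(\Theta)$, the same for all nodes and graphs, when $i$ has no parents. The Bayesian network $(G,\Theta)$ has the density $\prod_i \exp(\eta_i^{T}T(x_i)-\psi(\eta_i))h(x_i)$. Let $\mathcal P$ be a nonempty family of parameter maps, let $\Delta(\eta_1,\eta_2)=(\eta_1-\eta_2)^{T}(\mathbb E[T\mid\eta_1]-\mathbb E[T\mid\eta_2])$, and suppose that $\Delta_{\max}>0$ satisfies $\mathbb E_{X_{\pi_i}}[\Delta(\eta_i,\eta_0)]\le\Delta_{\max}$ for all $\Theta\in\mathcal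 P$, $G\in\mathcal G$ and $i\in\{1,\dots,m\}$. For a prior $P_G$ on $\mathcal G$ and a sample size $n$, the estimation error is $$p_{\mathrm{err}}=\inf_{\mathrm{Dec}}\ \sup_{P_\Theta}\ \sum_{G} \int P_G(G)\,\Pr\big(\mathrm{Dec}(S)\notin[G]\,\big|\,G,\Theta\big)\,dP_\Theta(\Theta),$$ where $S$ consists of $n$ i.i.d. observations from $(G,\Theta)$, $\mathrm{Dec}$ ranges over all functions from data sets to $\mathcal G$, $P_\Theta$ ranges over all probability measures on $\mathcal P$, and $[G]$ is the Markov equivalence class of $G$. Call $\mathcal L=\mathcal L(\Delta_{\max})$ a *necessary number of samples* for $\mathcal G$ if there is a nonempty (difficult) set $\mathcal G'\subseteq\mathcal G$, not depending on the exponential family, on $\mathcal P$, on $\Delta_{\max}$ or on $n$, such that for $G$ uniform on $\mathcal G'$ one has $p_{\mathrm{err}}\ge 1/2$ whenever $n\le\mathcal L(\Delta_{\max})$. **Corollary 2 (Fundamental limits of BN structure learning).** 1. For every $m$, a necessary number of samples for $\mathcal G_m$ is $$\mathcal L=\frac{\log 2}{\Delta_{\max}}\Big(\frac{m-3}{2}-\frac1m\Big).$$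 2. For all $m>2$ and $k<m$, a necessary number of samples for $\mathcal G_{m,k}$ is $$\mathcal L=\frac1{2\Delta_{\max}}\Big(k\log(m-2)+\frac{k(k-3)\log 2}{2m}-R(m,k)\Big),$$ where $R(m,k)=\frac km\big\{(m-2)+2\log(m-2)+\log k!+(m-k-2)\log k\big\}+\frac{\log 2}{m}$ (for $k=0$ the term $k\log k$ is read as $0$). 3. Consequently $\Omega(m/\Delta_{\max})$ samples are necessary for $\mathcal G_m$: there are an absolute constant $c>0$ and an $m_0$ such that $cm/\Delta_{\max}$ is a necessary number of samples for all $m\ge m_0$. 4. Likewise $\Omega\big((k\log m+k^2/m)/\Delta_{\max}\big)$ samples are necessary for sparse networks: for every $0<a<1$ there are $c>0$ and $m_0$, depending only on $a$, such that $c\,(k\log m+k^2/m)/\Delta_{\max}$ is a necessary number of samples for $\mathcal G_{m,k}$ for all $m\ge m_0$ and $1\le k\le m^{a}$. -/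

import Mathlib

universe u v

open MeasureTheory
open scoped ENNReal

/-! ## Directed acyclic graphs and Markov equivalence -/

/-- A directed acyclic graph on the vertex set `Fin m`: no directed closed walk of positive length.
`Adj u v` is the edge `u → v`. -/
structure DAG (m : ℕ) where
  Adj : Fin m → Fin m → Prop
  acyclic : ∀ v, ¬ Relation.TransGen Adj v v

/-- The parent set of `i`. -/
def DAG.parents {m : ℕ} (G : DAG m) (i : Fin m) : Set (Fin m) := {j | G.Adj j i}

/-- A trail: a sequence of distinct vertices, consecutive ones joined by an edge
in one of the two directions. -/
def DAG.IsTrail {m : ℕ} (G : DAG m) (l : List (Fin m)) : Prop :=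
  l.Nodup ∧ l.IsChain (fun u v => G.Adj u v ∨ G.Adj v u)

/-- A trail is active given `C` if, at each inner vertex `v`, either `v` is a collider
(`u → v ← w`) that is in `C` or has a descendant in `C`, or `v` is no collider and is not in `C`. -/
def DAG.IsActive {m : ℕ} (G : DAG m) (C : Set (Fin m)) (l : List (Fin m)) : Prop :=
  ∀ u v w, [u, v, w] <:+: l →
    ((G.Adj u v ∧ G.Adj w v) → ∃ c ∈ C, Relation.ReflTransGen G.Adj v c) ∧
    (¬ (G.Adj u v ∧ G.Adj w v) → v ∉ C)

/-- d-separation of `A` and `B` by `C` (the graph `G` asserts that `X_A` and `X_B` are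
conditionally independent given `X_C`). -/
def DAG.DSep {m : ℕ} (G : DAG m) (A B C : Set (Fin m)) : Prop :=
  ∀ a ∈ A, ∀ b ∈ B, ∀ l : List (Fin m), l.head? = some a → l.getLast? = some b →
    G.IsTrail l → ¬ G.IsActive C l

/-- Two DAGs are Markov equivalent if they make the same conditional independence assertions. -/
def DAG.MarkovEquiv {m : ℕ} (G₁ G₂ : DAG m) : Prop :=
  ∀ A B C : Set (Fin m), Disjoint A B → Disjoint A C → Disjoint B C →
    (G₁.DSep A B C ↔ G₂.DSep A B C)

/-- The class of all DAGs on `m` nodes. -/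
def allDAGs (m : ℕ) : Set (DAG m) := Set.univ

/-- The class of DAGs on `m` nodes in which each node has at most `k` parents. -/
def sparseDAGs (m k : ℕ) : Set (DAG m) := {G | ∀ i, (G.parents i).ncard ≤ k}

/-! ## Exponential families -/

/-- An exponential family on `𝒳` with `d`-dimensional sufficient statistic `T`. The measure `base`
is `h(x) dx`, the carrier density times the reference measure (Lebesgue, counting, ...). -/
structure ExpFamily (𝒳 : Type*) [MeasurableSpace 𝒳] (d : ℕ) where
  base : Measure 𝒳
  sigmaFinite_base : SigmaFinite base
  base_ne_zero : base ≠ 0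
  T : 𝒳 → EuclideanSpace ℝ (Fin d)
  measurable_T : Measurable T

namespace ExpFamily

variable {𝒳 : Type*} [MeasurableSpace 𝒳] {d : ℕ} (F : ExpFamily 𝒳 d)

/-- The log-partition function `ψ(η)`. -/
noncomputable def logPartition (η : EuclideanSpace ℝ (Fin d)) : ℝ :=
  Real.log (∫ x, Real.exp (inner ℝ η (F.T x)) ∂F.base)

/-- The density `exp(ηᵀ T(x) - ψ(η))` with respect to `base`. -/
noncomputable def density (η : EuclideanSpace ℝ (Fin d)) (x : 𝒳) : ℝ :=
  Real.exp (inner ℝ η (F.T x) - F.logPartition η)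

/-- The member of the family with natural parameter `η`. -/
noncomputable def dist (η : EuclideanSpace ℝ (Fin d)) : Measure 𝒳 :=
  F.base.withDensity (fun x => ENNReal.ofReal (F.density η x))

/-- The natural parameters for which the distribution and its expected sufficient statistic
exist. -/
def params : Set (EuclideanSpace ℝ (Fin d)) :=
  {η | Integrable (fun x => Real.exp (inner ℝ η (F.T x))) F.base ∧ Integrable F.T (F.dist η)}

/-- The expected sufficient statistic under the natural parameter `η`. -/
noncomputable def meanT (η : EuclideanSpace ℝ (Fin d)) : EuclideanSpace ℝ (Fin d) :=
  ∫ x, F.T x ∂(F.dist η)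

/-- `Δ(η₁, η₂) = (η₁ - η₂)ᵀ (E[T | η₁] - E[T | η₂])`. -/
noncomputable def Delta (η₁ η₂ : EuclideanSpace ℝ (Fin d)) : ℝ :=
  inner ℝ (η₁ - η₂) (F.meanT η₁ - F.meanT η₂)

end ExpFamily

/-! ## Bayesian networks over a class of DAGs -/

/-- A family of parameter maps, indexed by `w : W`, for the DAGs of the class `𝒢`, all variables
taking values in `𝒳`. The map with index `w` gives, for a DAG `G` and a node `i`, the conditional
distribution of `X_i` given its parents: the member of the exponential family whose natural
parameter is `η w G i` evaluated at the values of the parents. A node without parents has the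
natural parameter `η₀ w`, whatever the node and the graph. -/
structure BNFamily {m : ℕ} (𝒢 : Set (DAG m)) (𝒳 : Type*) [MeasurableSpace 𝒳] (W : Type*)
    (d : ℕ) where
  fam : ExpFamily 𝒳 d
  η₀ : W → EuclideanSpace ℝ (Fin d)
  η : W → (G : 𝒢) → (i : Fin m) → (G.1.parents i → 𝒳) → EuclideanSpace ℝ (Fin d)
  η₀_mem : ∀ w, η₀ w ∈ fam.params
  η_mem : ∀ w G i x, η w G i x ∈ fam.params
  measurable_η : ∀ w G i, Measurable (η w G i)
  η_root : ∀ w (G : 𝒢) i, G.1.parents i = ∅ → ∀ x, η w G i x = η₀ w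

namespace BNFamily

variable {m : ℕ} {𝒢 : Set (DAG m)} {𝒳 : Type*} [MeasurableSpace 𝒳] {W : Type*} {d : ℕ}
  (B : BNFamily 𝒢 𝒳 W d)

/-- The natural parameter of node `i` at the joint assignment `x`; only the coordinates of the
parents of `i` enter. -/
def nodeParam (w : W) (G : 𝒢) (i : Fin m) (x : Fin m → 𝒳) : EuclideanSpace ℝ (Fin d) :=
  B.η w G i (fun j => x j.1)

/-- The joint distribution of `(X_1, ..., X_m)`: its density is the product over the nodes of the
conditional densities given the parents. -/
noncomputable def law (w : W) (G : 𝒢) : Measure (Fin m → 𝒳) :=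
  (Measure.pi (fun _ => B.fam.base)).withDensity
    (fun x => ∏ i, ENNReal.ofReal (B.fam.density (B.nodeParam w G i x) (x i)))

/-- The distribution of a data set of `n` i.i.d. observations. -/
noncomputable def dataLaw (n : ℕ) (w : W) (G : 𝒢) : Measure (Fin n → Fin m → 𝒳) :=
  Measure.pi (fun _ => B.law w G)

/-- For all parameter maps, all graphs of the class and all nodes, the expectation over the parents
of `Δ(η_i, η_0)` is at most `Δmax`. -/
def DeltaBound (Δmax : ℝ) : Prop :=
  ∀ (w : W) (G : 𝒢) (i : Fin m),
    ∫⁻ x, ENNReal.ofReal (B.fam.Delta (B.nodeParam w G i x) (B.η₀ w)) ∂(B.law w G)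
      ≤ ENNReal.ofReal Δmax

/-- The estimation error with `n` samples when the graph has the prior `PG`: the infimum over all
decoders `dec` of the supremum over all probability measures `PW` on the parameter maps (drawn
independently of the graph) of the probability that the decoded graph is not Markov equivalent to
the true one. -/
noncomputable def err [MeasurableSpace W] (n : ℕ) (PG : PMF 𝒢) : ℝ≥0∞ :=
  ⨅ dec : (Fin n → Fin m → 𝒳) → 𝒢,
    ⨆ (PW : Measure W) (_ : IsProbabilityMeasure PW),
      ∑' G : 𝒢, ∫⁻ w, PG G * B.dataLaw n w G {S | ¬ (dec S).1.MarkovEquiv G.1} ∂PW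

end BNFamily

/-- `L Δmax` is a necessary number of samples for learning the structure of Bayesian networks whose
graph is in the class `𝒢`. There is a nonempty (difficult) ensemble `𝒢'` of graphs of the class such
that, if the graph is drawn uniformly from `𝒢'`, then for each exponential family, each family of
parameter maps for the class that meets the bound `Δmax > 0`, and each sample size
`n ≤ L Δmax`, the estimation error is at least `1/2`. The decoder may output
any graph of the class. -/
def IsNecessary {m : ℕ} (𝒢 : Set (DAG m)) (L : ℝ → ℝ) : Prop :=
  ∃ (𝒢' : Finset 𝒢) (h𝒢' : 𝒢'.Nonempty),
    ∀ (𝒳 : Type u) [MeasurableSpace 𝒳]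
      (W : Type v) [MeasurableSpace W] [MeasurableSingletonClass W] [Nonempty W]
      (d : ℕ) (B : BNFamily 𝒢 𝒳 W d) (Δmax : ℝ) (n : ℕ),
      0 < Δmax → B.DeltaBound Δmax → (n : ℝ) ≤ L Δmax →
        1 / 2 ≤ B.err n (PMF.uniformOfFinset 𝒢' h𝒢')

/-- The remainder `R(m, k)`. -/
noncomputable def remainder (m k : ℕ) : ℝ :=
  ((k : ℝ) / m) * (((m : ℝ) - 2) + 2 * Real.log ((m : ℝ) - 2) + Real.log (Nat.factorial k : ℝ)
    + ((m : ℝ) - k - 2) * Real.log k) + Real.log 2 / m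

/-! The proof applies Fano's inequality to a small ensemble. Two fixed nodes are sinks and receive
arbitrary parent sets of size at most `k` among the other `m - 2` nodes, which have no parents. No
two of these `sumChoose (m - 2) k ^ 2` graphs are Markov equivalent, since a source and a sink are
d-separated by the empty set exactly when they are not adjacent (`eq_of_markovEquiv_twoSinkDAG`).

For a fixed parameter map, the edgeless network with parameter `η₀` serves as a common reference
measure. Only the two sinks contribute to the log-likelihood ratio. Each contributes at most `Δmax`
in expectation, because `Δ` is the sum of the relative entropies in both directions
(`integral_llr_le_Delta`). Hence `n` samples have divergence at most `2 n Δmax` from the reference,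
and Fano (`sum_measureReal_le_of_integral_llr_le`) forces error at least `1/2` once `2 n Δmax ≤ log
(sumChoose (m - 2) k) - log 2` (`isNecessary_of_twoSink`).

What remains is to bound `sumChoose n k` from below: by `2 ^ n` if `n ≤ k`, by `2 ^ (n - 1)` if `n ≤
2 k`, and by `(n / k) ^ k` if `k ≤ n`. -/

namespace MeasureTheory

/-! ### Integrals and densities on product spaces. -/

theorem lintegral_fin_nat_prod_eq_prod {n : ℕ} {E : Fin n → Type*}
    {mE : ∀ i, MeasurableSpace (E i)} {μ : (i : Fin n) → Measure (E i)} [∀ i, SigmaFinite (μ i)]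
    {f : (i : Fin n) → E i → ℝ≥0∞} (hf : ∀ i, Measurable (f i)) :
    ∫⁻ x : (i : Fin n) → E i, ∏ i, f i (x i) ∂(Measure.pi μ) = ∏ i, ∫⁻ x, f i x ∂(μ i) := by
  induction n with
  | zero => simp
  | succ n ih =>
    calc
      _ = ∫⁻ x : E 0 × ((i : Fin n) → E (Fin.succ i)),
            f 0 x.1 * ∏ i : Fin n, f (Fin.succ i) (x.2 i)
            ∂((μ 0).prod (Measure.pi (fun i ↦ μ i.succ))) := by
          rw [← ((measurePreserving_piFinSuccAbove μ 0).symm).lintegral_comp_emb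
            (MeasurableEquiv.measurableEmbedding _)]
          simp_rw [MeasurableEquiv.piFinSuccAbove_symm_apply, Fin.insertNthEquiv,
            Fin.prod_univ_succ, Fin.insertNth_zero, Equiv.coe_fn_mk, Fin.cons_succ, Fin.cons_zero]
          rfl
      _ = (∫⁻ x, f 0 x ∂μ 0)
            * ∏ i : Fin n, ∫⁻ (x : E (Fin.succ i)), f (Fin.succ i) x ∂(μ i.succ) := by
          rw [← ih fun i => hf i.succ]
          have hg : Measurable fun x : (i : Fin n) → E i.succ => ∏ i, f i.succ (x i) :=
            Finset.measurable_fun_prod _ fun i _ => (hf i.succ).comp (measurable_pi_apply i)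
          exact lintegral_prod_mul (hf 0).aemeasurable hg.aemeasurable
      _ = ∏ i, ∫⁻ x, f i x ∂(μ i) := by rw [Fin.prod_univ_succ]

theorem Measure.pi_eq_withDensity {n : ℕ} {E : Fin n → Type*}
    {mE : ∀ i, MeasurableSpace (E i)} {μ ν : (i : Fin n) → Measure (E i)} [∀ i, SigmaFinite (μ i)]
    [∀ i, SigmaFinite (ν i)] {f : (i : Fin n) → E i → ℝ≥0∞} (hf : ∀ i, Measurable (f i))
    (hν : ∀ i, ν i = (μ i).withDensity (f i)) :
    Measure.pi ν = (Measure.pi μ).withDensity (fun x => ∏ i, f i (x i)) := by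
  refine Measure.pi_eq fun s hs => ?_
  rw [withDensity_apply _ (MeasurableSet.univ_pi hs), Measure.restrict_pi_pi,
    lintegral_fin_nat_prod_eq_prod hf]
  exact Finset.prod_congr rfl fun i _ => by rw [hν, withDensity_apply _ (hs i)]

/-- Integrating out a coordinate `i` that enters the density only through a factor `r` whose
integral over that coordinate is one. -/
theorem lintegral_pi_mul_eq_lintegral_update {ι : Type*} [Fintype ι] [DecidableEq ι]
    {E : ι → Type*} {mE : ∀ i, MeasurableSpace (E i)} {μ : (i : ι) → Measure (E i)}
    [∀ i, SigmaFinite (μ i)] {i : ι} {R r h : (∀ i, E i) → ℝ≥0∞}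
    (hR : Measurable R) (hr : Measurable r) (hh : Measurable h)
    (hRi : ∀ x y, R (Function.update x i y) = R x)
    (hri : ∀ x, ∫⁻ y, r (Function.update x i y) ∂μ i = 1) :
    ∫⁻ x, (R x * r x) * h x ∂Measure.pi μ =
      ∫⁻ x, (R x * r x) * (∫⁻ y, r (Function.update x i y) * h (Function.update x i y) ∂μ i)
        ∂Measure.pi μ := by
  have hm : Measurable fun x : ∀ i, E i =>
      ∫⁻ y, r (Function.update x i y) * h (Function.update x i y) ∂μ i :=
    Measurable.lintegral_prod_right ((hr.mul hh).comp measurable_update')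
  -- It suffices to compare the two sides after integrating over coordinate `i` alone, where `R` is
  -- constant.
  refine lintegral_eq_of_lmarginal_eq {i} ((hR.mul hr).mul hh) ((hR.mul hr).mul hm) ?_
  simp only [lmarginal_singleton]
  funext x
  have hru : Measurable fun y => r (Function.update x i y) := hr.comp (measurable_update x)
  have hrhu : Measurable fun y => r (Function.update x i y) * h (Function.update x i y) :=
    hru.mul (hh.comp (measurable_update x))
  simp only [hRi, Function.update_idem, mul_assoc]
  rw [lintegral_const_mul _ hrhu, lintegral_const_mul _ (hru.mul_const _),
    lintegral_mul_const _ hru, hri, one_mul]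

theorem lintegral_pi_mul_of_lintegral_update_eq_one {ι : Type*} [Fintype ι] [DecidableEq ι]
    {E : ι → Type*} {mE : ∀ i, MeasurableSpace (E i)} {μ : (i : ι) → Measure (E i)}
    [∀ i, IsProbabilityMeasure (μ i)] {i : ι} {R r : (∀ i, E i) → ℝ≥0∞}
    (hR : Measurable R) (hr : Measurable r)
    (hRi : ∀ x y, R (Function.update x i y) = R x)
    (hri : ∀ x, ∫⁻ y, r (Function.update x i y) ∂μ i = 1) :
    ∫⁻ x, R x * r x ∂Measure.pi μ = ∫⁻ x, R x ∂Measure.pi μ := by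
  refine lintegral_eq_of_lmarginal_eq {i} (hR.mul hr) hR ?_
  simp only [lmarginal_singleton]
  funext x
  have hru : Measurable fun y => r (Function.update x i y) := hr.comp (measurable_update x)
  simp only [hRi]
  rw [lintegral_const_mul _ hru, hri]
  simp

end MeasureTheory

/-! ### Change of measure and Fano's inequality. -/

/-- A change-of-measure bound for the probability of an event in terms of the expected
log-likelihood ratio. -/
theorem mul_measureReal_le_integral_llr {Ω : Type*} [MeasurableSpace Ω] {P Q : Measure Ω}
    [IsProbabilityMeasure P] [IsProbabilityMeasure Q] {ℓ : Ω → ℝ} (hℓ : Measurable ℓ)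
    (hP : P = Q.withDensity fun x => ENNReal.ofReal (Real.exp (ℓ x))) (hint : Integrable ℓ P)
    {B : Set Ω} (hB : MeasurableSet B) (t : ℝ) :
    t * P.real B ≤ ∫ x, ℓ x ∂P + Real.log 2 + (1 + (Real.exp t - 1) * Q.real B) / 2 - 1 := by
  -- Donsker–Varadhan with this test function, in the form `u + 1 ≤ exp u`. The shift `log 2` is
  -- nearly optimal: for `t = log N` and `Q B = 1 / N`, the `Q`-mean of `exp (t 1_B)` is just below
  -- `2`.
  set f : Ω → ℝ := fun x => B.indicator (fun _ => t) x - Real.log 2 with hf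
  have hfint : Integrable f P :=
    ((integrable_const t).indicator hB).sub (integrable_const _)
  have hexp : ∀ x, Real.exp (f x) = 1 / 2 + B.indicator (fun _ => (Real.exp t - 1) / 2) x := by
    intro x
    by_cases hx : x ∈ B
    · simp only [hf, hx, Set.indicator_of_mem, Real.exp_sub,
        Real.exp_log (show (0 : ℝ) < 2 by norm_num)]
      ring
    · simp [hf, hx, Real.exp_neg, Real.exp_log (show (0 : ℝ) < 2 by norm_num)]
  have hdm : Measurable fun x => ENNReal.ofReal (Real.exp (ℓ x)) := by fun_prop
  have hcancel : ∀ x, (ENNReal.ofReal (Real.exp (ℓ x))).toReal • Real.exp (f x - ℓ x) =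
      1 / 2 + B.indicator (fun _ => (Real.exp t - 1) / 2) x := by
    intro x
    rw [ENNReal.toReal_ofReal (Real.exp_pos _).le, smul_eq_mul, ← Real.exp_add, ← hexp]
    congr 1
    ring
  have hgint : Integrable (fun x => (1 / 2 : ℝ) + B.indicator (fun _ => (Real.exp t - 1) / 2) x) Q :=
    (integrable_const _).add ((integrable_const _).indicator hB)
  have hEint : Integrable (fun x => Real.exp (f x - ℓ x)) P := by
    rw [hP, integrable_withDensity_iff_integrable_smul' hdm (by simp)]
    simpa only [hcancel] using hgint
  have hE : ∫ x, Real.exp (f x - ℓ x) ∂P = (1 + (Real.exp t - 1) * Q.real B) / 2 := by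
    rw [hP, integral_withDensity_eq_integral_toReal_smul hdm (by simp)]
    simp only [hcancel]
    rw [integral_add (integrable_const _) ((integrable_const _).indicator hB),
      integral_indicator_const _ hB]
    simp
    ring
  have hF : ∫ x, f x ∂P = t * P.real B - Real.log 2 := by
    rw [hf, integral_sub ((integrable_const t).indicator hB) (integrable_const _),
      integral_indicator_const _ hB]
    simp [mul_comm]
  have key : ∫ x, (f x - ℓ x + 1) ∂P ≤ ∫ x, Real.exp (f x - ℓ x) ∂P :=
    integral_mono ((hfint.sub hint).add (integrable_const _)) hEint
      fun x => Real.add_one_le_exp _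
  have hl : ∫ x, (f x - ℓ x + 1) ∂P = ∫ x, f x ∂P - ∫ x, ℓ x ∂P + 1 := by
    have hfl : Integrable (fun x => f x - ℓ x) P := hfint.sub hint
    rw [integral_add hfl (integrable_const _), integral_sub hfint hint]
    simp
  rw [hl, hF, hE] at key
  linarith

/-- **Fano's inequality**, for disjoint decision regions and a reference measure `Q`. -/
theorem sum_measureReal_le_of_integral_llr_le {Ω ι : Type*} [MeasurableSpace Ω] [Fintype ι]
    {P : ι → Measure Ω} {Q : Measure Ω} [∀ i, IsProbabilityMeasure (P i)] [IsProbabilityMeasure Q]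
    {ℓ : ι → Ω → ℝ} (hℓ : ∀ i, Measurable (ℓ i))
    (hP : ∀ i, P i = Q.withDensity fun x => ENNReal.ofReal (Real.exp (ℓ i x)))
    (hint : ∀ i, Integrable (ℓ i) (P i)) {K : ℝ} (hK₀ : 0 ≤ K)
    (hK : ∀ i, ∫ x, ℓ i x ∂P i ≤ K) (hcard : K ≤ Real.log (Fintype.card ι) / 2 - Real.log 2)
    {B : ι → Set Ω} (hB : ∀ i, MeasurableSet (B i)) (hdisj : Pairwise (Function.onFun Disjoint B)) :
    ∑ i, (P i).real (B i) ≤ Fintype.card ι / 2 := by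
  set N : ℝ := (Fintype.card ι : ℝ) with hN
  have hlog2 : 0 < Real.log 2 := Real.log_pos one_lt_two
  have hlogN : 0 < Real.log N := by linarith
  -- As `K ≥ 0`, `hcard` already forces `log N ≥ 2 log 2`, so small ensembles need no separate
  -- treatment.
  have hN1 : 1 < N := by
    by_contra h
    exact absurd (Real.log_nonpos (by positivity) (not_lt.mp h)) (not_le.mpr hlogN)
  have hQ : ∑ i, Q.real (B i) ≤ 1 := by
    rw [← measureReal_iUnion_fintype hdisj hB]
    exact measureReal_le_one
  have h1 : ∀ i, Real.log N * (P i).real (B i) ≤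
      K + Real.log 2 - 1 / 2 + (N - 1) / 2 * Q.real (B i) := by
    intro i
    have := mul_measureReal_le_integral_llr (hℓ i) (hP i) (hint i) (hB i) (Real.log N)
    rw [Real.exp_log (by linarith)] at this
    linarith [hK i]
  have h2 := Finset.sum_le_sum fun i (_ : i ∈ Finset.univ) => h1 i
  rw [← Finset.mul_sum, Finset.sum_add_distrib, ← Finset.mul_sum, Finset.sum_const,
    Finset.card_univ, nsmul_eq_mul, ← hN] at h2
  have h3 : (N - 1) / 2 * ∑ i, Q.real (B i) ≤ (N - 1) / 2 :=
    mul_le_of_le_one_right (by linarith) hQ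
  refine le_of_mul_le_mul_left ?_ hlogN
  nlinarith

/-! ### Relative entropy in an exponential family. -/

theorem Real.add_exp_neg_sub_one_nonneg (u : ℝ) : 0 ≤ u + Real.exp (-u) - 1 := by
  linarith [Real.add_one_le_exp (-u)]

namespace ExpFamily

variable {𝒳 : Type*} [MeasurableSpace 𝒳] {d : ℕ} (F : ExpFamily 𝒳 d)

instance : SigmaFinite F.base := F.sigmaFinite_base

instance : NeZero F.base := ⟨F.base_ne_zero⟩

theorem measurable_logPartition : Measurable F.logPartition := by
  refine Real.measurable_log.comp (StronglyMeasurable.measurable ?_)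
  refine StronglyMeasurable.integral_prod_right
    (f := fun (η : EuclideanSpace ℝ (Fin d)) x => Real.exp (inner ℝ η (F.T x)))
    (Measurable.stronglyMeasurable ?_)
  exact Real.measurable_exp.comp (measurable_fst.inner (F.measurable_T.comp measurable_snd))

theorem measurable_density (η : EuclideanSpace ℝ (Fin d)) : Measurable (F.density η) :=
  Real.measurable_exp.comp ((measurable_const.inner F.measurable_T).sub measurable_const)

theorem density_pos (η : EuclideanSpace ℝ (Fin d)) (x : 𝒳) : 0 < F.density η x :=
  Real.exp_pos _

theorem isProbabilityMeasure_dist {η : EuclideanSpace ℝ (Fin d)} (hη : η ∈ F.params) :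
    IsProbabilityMeasure (F.dist η) := by
  constructor
  -- Positivity comes from `base ≠ 0`; without it `Real.log` in `logPartition` would not be undone
  -- by `exp`.
  have hpos : 0 < ∫ x, Real.exp (inner ℝ η (F.T x)) ∂F.base := integral_exp_pos hη.1
  have hd : ∀ x, F.density η x =
      Real.exp (inner ℝ η (F.T x)) * (∫ x, Real.exp (inner ℝ η (F.T x)) ∂F.base)⁻¹ := by
    intro x
    rw [density, logPartition, Real.exp_sub, Real.exp_log hpos, div_eq_mul_inv]
  have hint : Integrable (F.density η) F.base := by
    rw [show F.density η = _ from funext hd]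
    exact hη.1.mul_const _
  rw [dist, withDensity_apply _ MeasurableSet.univ, Measure.restrict_univ,
    ← ofReal_integral_eq_lintegral_ofReal hint (ae_of_all _ fun x => (F.density_pos η x).le)]
  simp_rw [hd]
  rw [integral_mul_const, mul_inv_cancel₀ hpos.ne', ENNReal.ofReal_one]

/-- The log-likelihood ratio of the members `η` and `η₀` of the family. -/
noncomputable def llr (η η₀ : EuclideanSpace ℝ (Fin d)) (x : 𝒳) : ℝ :=
  inner ℝ (η - η₀) (F.T x) - F.logPartition η + F.logPartition η₀

@[simp]
theorem llr_self (η : EuclideanSpace ℝ (Fin d)) (x : 𝒳) : F.llr η η x = 0 := by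
  simp [llr]

theorem llr_swap (η η₀ : EuclideanSpace ℝ (Fin d)) (x : 𝒳) : F.llr η η₀ x = -F.llr η₀ η x := by
  simp only [llr, inner_sub_left]
  ring

theorem measurable_llr_comp {α : Type*} [MeasurableSpace α] {η : α → EuclideanSpace ℝ (Fin d)}
    (hη : Measurable η) (η₀ : EuclideanSpace ℝ (Fin d)) {f : α → 𝒳} (hf : Measurable f) :
    Measurable fun a => F.llr (η a) η₀ (f a) :=
  (((hη.sub_const _).inner (F.measurable_T.comp hf)).sub
    (F.measurable_logPartition.comp hη)).add_const _

theorem measurable_llr (η η₀ : EuclideanSpace ℝ (Fin d)) : Measurable (F.llr η η₀) :=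
  F.measurable_llr_comp measurable_const η₀ measurable_id

theorem density_eq_mul_exp_llr (η η₀ : EuclideanSpace ℝ (Fin d)) (x : 𝒳) :
    F.density η x = F.density η₀ x * Real.exp (F.llr η η₀ x) := by
  simp only [density, llr, ← Real.exp_add, inner_sub_left]
  congr 1
  ring

theorem dist_eq_withDensity_exp_llr (η η₀ : EuclideanSpace ℝ (Fin d)) :
    F.dist η = (F.dist η₀).withDensity fun x => ENNReal.ofReal (Real.exp (F.llr η η₀ x)) := by
  rw [dist, dist, ← withDensity_mul _ (F.measurable_density η₀).ennreal_ofReal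
    (F.measurable_llr η η₀).exp.ennreal_ofReal]
  congr 1
  funext x
  rw [Pi.mul_apply, ← ENNReal.ofReal_mul (F.density_pos η₀ x).le, ← density_eq_mul_exp_llr]

theorem lintegral_exp_llr {η : EuclideanSpace ℝ (Fin d)} (hη : η ∈ F.params)
    (η₀ : EuclideanSpace ℝ (Fin d)) :
    ∫⁻ x, ENNReal.ofReal (Real.exp (F.llr η η₀ x)) ∂F.dist η₀ = 1 := by
  have := (F.isProbabilityMeasure_dist hη).measure_univ
  rwa [F.dist_eq_withDensity_exp_llr η η₀, withDensity_apply _ MeasurableSet.univ,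
    Measure.restrict_univ] at this

theorem integrable_exp_llr {η : EuclideanSpace ℝ (Fin d)} (hη : η ∈ F.params)
    (η₀ : EuclideanSpace ℝ (Fin d)) :
    Integrable (fun x => Real.exp (F.llr η η₀ x)) (F.dist η₀) := by
  rw [← lintegral_ofReal_ne_top_iff_integrable (F.measurable_llr η η₀).exp.aestronglyMeasurable
    (ae_of_all _ fun x => (Real.exp_pos _).le), F.lintegral_exp_llr hη]
  exact ENNReal.one_ne_top

theorem integral_exp_llr {η : EuclideanSpace ℝ (Fin d)} (hη : η ∈ F.params)
    (η₀ : EuclideanSpace ℝ (Fin d)) :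
    ∫ x, Real.exp (F.llr η η₀ x) ∂F.dist η₀ = 1 := by
  rw [integral_eq_lintegral_of_nonneg_ae (ae_of_all _ fun x => (Real.exp_pos _).le)
    (F.measurable_llr η η₀).exp.aestronglyMeasurable, F.lintegral_exp_llr hη, ENNReal.toReal_one]

theorem integrable_llr {η' : EuclideanSpace ℝ (Fin d)} (hη' : η' ∈ F.params)
    (η η₀ : EuclideanSpace ℝ (Fin d)) : Integrable (F.llr η η₀) (F.dist η') := by
  have := F.isProbabilityMeasure_dist hη'
  exact ((hη'.2.const_inner _).sub (integrable_const _)).add (integrable_const _)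

theorem integral_llr {η' : EuclideanSpace ℝ (Fin d)} (hη' : η' ∈ F.params)
    (η η₀ : EuclideanSpace ℝ (Fin d)) :
    ∫ x, F.llr η η₀ x ∂F.dist η' =
      inner ℝ (η - η₀) (F.meanT η') - F.logPartition η + F.logPartition η₀ := by
  have := F.isProbabilityMeasure_dist hη'
  have hi : Integrable (fun x => inner ℝ (η - η₀) (F.T x)) (F.dist η') := hη'.2.const_inner _
  have hi' : Integrable (fun x => inner ℝ (η - η₀) (F.T x) - F.logPartition η) (F.dist η') :=
    hi.sub (integrable_const _)
  simp only [llr]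
  rw [integral_add hi' (integrable_const _), integral_sub hi (integrable_const _),
    integral_inner hη'.2]
  simp [meanT]

/-- Gibbs' inequality. -/
theorem integral_llr_nonpos {η η₀ : EuclideanSpace ℝ (Fin d)} (hη : η ∈ F.params)
    (hη₀ : η₀ ∈ F.params) : ∫ x, F.llr η η₀ x ∂F.dist η₀ ≤ 0 := by
  have := F.isProbabilityMeasure_dist hη₀
  have hi := F.integrable_llr hη₀ η η₀
  have h : ∫ x, (F.llr η η₀ x + 1) ∂F.dist η₀ ≤ ∫ x, Real.exp (F.llr η η₀ x) ∂F.dist η₀ :=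
    integral_mono (hi.add (integrable_const _)) (F.integrable_exp_llr hη η₀)
      fun x => Real.add_one_le_exp _
  rw [F.integral_exp_llr hη, integral_add hi (integrable_const _)] at h
  simpa using h

/-- The relative entropy of two members of the family is at most `Δ`. -/
theorem integral_llr_le_Delta {η η₀ : EuclideanSpace ℝ (Fin d)} (hη : η ∈ F.params)
    (hη₀ : η₀ ∈ F.params) : ∫ x, F.llr η η₀ x ∂F.dist η ≤ F.Delta η η₀ := by
  -- `Δ` is the relative entropy plus the reverse one, and Gibbs makes the latter nonnegative.
  have h := F.integral_llr_nonpos hη hη₀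
  rw [F.integral_llr hη₀] at h
  rw [F.integral_llr hη, Delta, inner_sub_right]
  linarith

/-- Under `η` the variable `exp (-llr)` has mean one, so adding `exp (-llr) - 1` leaves the relative
entropy unchanged while making the integrand nonnegative. The bound can then be averaged over the
parents before any integrability is known. -/
theorem lintegral_llr_add_exp_neg_le_Delta {η η₀ : EuclideanSpace ℝ (Fin d)} (hη : η ∈ F.params)
    (hη₀ : η₀ ∈ F.params) :
    ∫⁻ x, ENNReal.ofReal (F.llr η η₀ x + Real.exp (-F.llr η η₀ x) - 1) ∂F.dist η ≤
      ENNReal.ofReal (F.Delta η η₀) := by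
  have := F.isProbabilityMeasure_dist hη
  simp only [← F.llr_swap η₀ η]
  have hi := F.integrable_llr hη η η₀
  have hi' : Integrable (fun x => F.llr η η₀ x + Real.exp (F.llr η₀ η x)) (F.dist η) :=
    hi.add (F.integrable_exp_llr hη₀ η)
  have hi'' : Integrable (fun x => F.llr η η₀ x + Real.exp (F.llr η₀ η x) - 1) (F.dist η) :=
    hi'.sub (integrable_const 1)
  rw [← ofReal_integral_eq_lintegral_ofReal hi''
    (ae_of_all _ fun x => ?_)]
  · refine ENNReal.ofReal_le_ofReal ?_
    rw [integral_sub hi' (integrable_const _), integral_add hi (F.integrable_exp_llr hη₀ η),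
      F.integral_exp_llr hη₀]
    simpa using F.integral_llr_le_Delta hη hη₀
  · simp only [F.llr_swap η₀ η]
    exact Real.add_exp_neg_sub_one_nonneg _

end ExpFamily

/-! ### Likelihood ratios of Bayesian networks on flat graphs. -/

/-- A DAG without directed paths of length two: each node lacks parents or lacks children. -/
def DAG.IsFlat {m : ℕ} (G : DAG m) : Prop := ∀ u v w, G.Adj u v → ¬ G.Adj v w

theorem DAG.not_adj_self {m : ℕ} (G : DAG m) (v : Fin m) : ¬ G.Adj v v :=
  fun h => G.acyclic v (.single h)

namespace BNFamily

variable {m : ℕ} {𝒢 : Set (DAG m)} {𝒳 : Type*} [MeasurableSpace 𝒳] {W : Type*} {d : ℕ}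
  (B : BNFamily 𝒢 𝒳 W d) (w : W) (G : 𝒢)

/-- The log-likelihood ratio of the conditional distribution of node `i` given its parents and the
common distribution of the parentless nodes. -/
noncomputable def nodeLlr (i : Fin m) (x : Fin m → 𝒳) : ℝ :=
  B.fam.llr (B.nodeParam w G i x) (B.η₀ w) (x i)

/-- The joint distribution of the variables in the network without edges. -/
noncomputable def emptyLaw : Measure (Fin m → 𝒳) :=
  Measure.pi fun _ => B.fam.dist (B.η₀ w)

instance isProbabilityMeasure_dist_η₀ : IsProbabilityMeasure (B.fam.dist (B.η₀ w)) :=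
  B.fam.isProbabilityMeasure_dist (B.η₀_mem w)

instance : IsProbabilityMeasure (B.emptyLaw w) := by
  unfold emptyLaw
  infer_instance

theorem measurable_nodeParam (i : Fin m) : Measurable (B.nodeParam w G i) :=
  (B.measurable_η w G i).comp (measurable_pi_lambda _ fun j => measurable_pi_apply j.1)

theorem measurable_nodeLlr (i : Fin m) : Measurable (B.nodeLlr w G i) :=
  B.fam.measurable_llr_comp (B.measurable_nodeParam w G i) _ (measurable_pi_apply i)

theorem measurable_exp_nodeLlr (i : Fin m) :
    Measurable fun x => ENNReal.ofReal (Real.exp (B.nodeLlr w G i x)) :=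
  (B.measurable_nodeLlr w G i).exp.ennreal_ofReal

theorem nodeParam_update {i j : Fin m} (h : ¬ G.1.Adj i j) (x : Fin m → 𝒳) (y : 𝒳) :
    B.nodeParam w G j (Function.update x i y) = B.nodeParam w G j x := by
  unfold nodeParam
  congr 1
  funext u
  refine Function.update_of_ne ?_ _ _
  rintro rfl
  exact h u.2

theorem nodeLlr_update_self (i : Fin m) (x : Fin m → 𝒳) (y : 𝒳) :
    B.nodeLlr w G i (Function.update x i y) =
      B.fam.llr (B.nodeParam w G i x) (B.η₀ w) y := by
  rw [nodeLlr, B.nodeParam_update w G (G.1.not_adj_self i), Function.update_self]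

theorem nodeLlr_update_of_ne {i j : Fin m} (hij : j ≠ i) (h : ¬ G.1.Adj i j) (x : Fin m → 𝒳)
    (y : 𝒳) : B.nodeLlr w G j (Function.update x i y) = B.nodeLlr w G j x := by
  rw [nodeLlr, B.nodeParam_update w G h, Function.update_of_ne hij, nodeLlr]

theorem nodeLlr_eq_zero {i : Fin m} (hi : ∀ u, ¬ G.1.Adj u i) (x : Fin m → 𝒳) :
    B.nodeLlr w G i x = 0 := by
  rw [nodeLlr, nodeParam, B.η_root w G i (Set.eq_empty_of_forall_notMem hi), ExpFamily.llr_self]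

theorem measurable_prod_density_η₀ : Measurable fun x : Fin m → 𝒳 =>
    ∏ i, ENNReal.ofReal (B.fam.density (B.η₀ w) (x i)) :=
  Finset.measurable_fun_prod _ fun i _ =>
    (B.fam.measurable_density _).ennreal_ofReal.comp (measurable_pi_apply i)

theorem emptyLaw_eq_withDensity :
    B.emptyLaw w = (Measure.pi fun _ => B.fam.base).withDensity
      fun x : Fin m → 𝒳 => ∏ i, ENNReal.ofReal (B.fam.density (B.η₀ w) (x i)) :=
by
  have hf : ∀ _ : Fin m, Measurable fun y => ENNReal.ofReal (B.fam.density (B.η₀ w) y) :=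
    fun _ => (B.fam.measurable_density _).ennreal_ofReal
  have h := Measure.pi_eq_withDensity (μ := fun _ => B.fam.base)
    (ν := fun _ => B.fam.dist (B.η₀ w))
    (f := fun _ y => ENNReal.ofReal (B.fam.density (B.η₀ w) y)) hf fun _ => rfl
  unfold emptyLaw
  rw [h]

theorem prod_density_mul_prod_exp_nodeLlr (x : Fin m → 𝒳) :
    (∏ i, ENNReal.ofReal (B.fam.density (B.η₀ w) (x i))) *
        ∏ i, ENNReal.ofReal (Real.exp (B.nodeLlr w G i x)) =
      ∏ i, ENNReal.ofReal (B.fam.density (B.nodeParam w G i x) (x i)) := by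
  rw [← Finset.prod_mul_distrib]
  refine Finset.prod_congr rfl fun i _ => ?_
  rw [← ENNReal.ofReal_mul (B.fam.density_pos _ _).le, nodeLlr, ← B.fam.density_eq_mul_exp_llr]

theorem law_eq_withDensity :
    B.law w G = (B.emptyLaw w).withDensity
      fun x => ∏ i, ENNReal.ofReal (Real.exp (B.nodeLlr w G i x)) := by
  rw [emptyLaw_eq_withDensity, ← withDensity_mul _ (B.measurable_prod_density_η₀ w)
    (Finset.measurable_fun_prod _ fun i _ => B.measurable_exp_nodeLlr w G i)]
  unfold law
  congr 1
  funext x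
  exact (B.prod_density_mul_prod_exp_nodeLlr w G x).symm

theorem lintegral_exp_nodeLlr_update (i : Fin m) (x : Fin m → 𝒳) :
    ∫⁻ y, ENNReal.ofReal (Real.exp (B.nodeLlr w G i (Function.update x i y)))
      ∂B.fam.dist (B.η₀ w) = 1 := by
  simp only [nodeLlr_update_self]
  exact B.fam.lintegral_exp_llr (B.η_mem w G i _) _

theorem prod_exp_nodeLlr_update {i : Fin m} (hi : ∀ v, ¬ G.1.Adj i v) {s : Finset (Fin m)}
    (his : i ∉ s) (x : Fin m → 𝒳) (y : 𝒳) :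
    ∏ j ∈ s, ENNReal.ofReal (Real.exp (B.nodeLlr w G j (Function.update x i y))) =
      ∏ j ∈ s, ENNReal.ofReal (Real.exp (B.nodeLlr w G j x)) :=
  Finset.prod_congr rfl fun j hj => by
    rw [B.nodeLlr_update_of_ne w G (ne_of_mem_of_not_mem hj his) (hi j)]

variable {G}

/-- In a flat graph a node with parents has no children, so its coordinate enters only its own
factor, which integrates to one. A parentless node has factor one. No topological ordering is
needed. -/
theorem lintegral_prod_exp_nodeLlr (hG : G.1.IsFlat) (s : Finset (Fin m)) :
    ∫⁻ x, ∏ i ∈ s, ENNReal.ofReal (Real.exp (B.nodeLlr w G i x)) ∂B.emptyLaw w = 1 := by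
  induction s using Finset.induction_on with
  | empty => simp
  | insert i s his ih =>
    simp only [Finset.prod_insert his]
    by_cases hi : ∃ u, G.1.Adj u i
    · obtain ⟨u, hu⟩ := hi
      simp only [mul_comm (ENNReal.ofReal _)]
      rw [← ih]
      exact lintegral_pi_mul_of_lintegral_update_eq_one
        (Finset.measurable_fun_prod _ fun j _ => B.measurable_exp_nodeLlr w G j)
        (B.measurable_exp_nodeLlr w G i)
        (B.prod_exp_nodeLlr_update w G (fun v => hG u i v hu) his)
        (B.lintegral_exp_nodeLlr_update w G i)
    · simpa only [B.nodeLlr_eq_zero w G (not_exists.mp hi), Real.exp_zero, ENNReal.ofReal_one,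
        one_mul] using ih

theorem isProbabilityMeasure_law (hG : G.1.IsFlat) : IsProbabilityMeasure (B.law w G) := by
  constructor
  rw [law_eq_withDensity, withDensity_apply _ MeasurableSet.univ, Measure.restrict_univ]
  exact B.lintegral_prod_exp_nodeLlr w hG _

/-- The conditional distribution of a childless node `i` given the other variables. -/
theorem lintegral_law_of_childless {i : Fin m} (hi : ∀ v, ¬ G.1.Adj i v)
    {h : (Fin m → 𝒳) → ℝ≥0∞} (hh : Measurable h) :
    ∫⁻ x, h x ∂B.law w G =
      ∫⁻ x, ∫⁻ y, h (Function.update x i y) ∂B.fam.dist (B.nodeParam w G i x) ∂B.law w G := by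
  have hD : Measurable fun x => ∏ j, ENNReal.ofReal (Real.exp (B.nodeLlr w G j x)) :=
    Finset.measurable_fun_prod _ fun j _ => B.measurable_exp_nodeLlr w G j
  have hR : Measurable fun x =>
      ∏ j ∈ Finset.univ.erase i, ENNReal.ofReal (Real.exp (B.nodeLlr w G j x)) :=
    Finset.measurable_fun_prod _ fun j _ => B.measurable_exp_nodeLlr w G j
  have hr := B.measurable_exp_nodeLlr w G i
  have hinner : ∀ x, ∫⁻ y, h (Function.update x i y) ∂B.fam.dist (B.nodeParam w G i x) =
      ∫⁻ y, ENNReal.ofReal (Real.exp (B.nodeLlr w G i (Function.update x i y))) *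
        h (Function.update x i y) ∂B.fam.dist (B.η₀ w) := by
    intro x
    have hhu : Measurable fun y => h (Function.update x i y) := hh.comp (measurable_update x)
    rw [B.fam.dist_eq_withDensity_exp_llr _ (B.η₀ w), lintegral_withDensity_eq_lintegral_mul _
      (B.fam.measurable_llr _ _).exp.ennreal_ofReal hhu]
    simp only [nodeLlr_update_self, Pi.mul_apply]
  have hm : Measurable fun x : Fin m → 𝒳 =>
      ∫⁻ y, ENNReal.ofReal (Real.exp (B.nodeLlr w G i (Function.update x i y))) *
        h (Function.update x i y) ∂B.fam.dist (B.η₀ w) :=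
    Measurable.lintegral_prod_right ((hr.mul hh).comp measurable_update')
  simp only [hinner]
  rw [law_eq_withDensity, lintegral_withDensity_eq_lintegral_mul _ hD hh,
    lintegral_withDensity_eq_lintegral_mul _ hD hm]
  simp only [Pi.mul_apply, ← Finset.prod_erase_mul _ _ (Finset.mem_univ i)]
  exact lintegral_pi_mul_eq_lintegral_update hR hr hh
    (B.prod_exp_nodeLlr_update w G hi (Finset.notMem_erase _ _))
    (B.lintegral_exp_nodeLlr_update w G i)

variable {w} {B} in
-- Conditioning on the parents reduces to the one-variable bound for `llr + exp (-llr) - 1`, whose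
-- finite integral gives integrability. Since `exp (-llr)` has mean one, subtracting it returns the
-- log-likelihood ratio with the same bound.
theorem integrable_nodeLlr_and_integral_le {Δmax : ℝ} (hΔ : 0 ≤ Δmax) (hB : B.DeltaBound Δmax)
    (hG : G.1.IsFlat) {i : Fin m} (hi : ∀ v, ¬ G.1.Adj i v) :
    Integrable (B.nodeLlr w G i) (B.law w G) ∧ ∫ x, B.nodeLlr w G i x ∂B.law w G ≤ Δmax := by
  have := B.isProbabilityMeasure_law w hG
  have hl := B.measurable_nodeLlr w G i
  have hem : Measurable fun x => Real.exp (-B.nodeLlr w G i x) := hl.neg.exp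
  have hφm : Measurable fun x => B.nodeLlr w G i x + Real.exp (-B.nodeLlr w G i x) - 1 :=
    (hl.add hem).sub_const _
  have hφle : ∫⁻ x, ENNReal.ofReal (B.nodeLlr w G i x + Real.exp (-B.nodeLlr w G i x) - 1)
      ∂B.law w G ≤ ENNReal.ofReal Δmax := by
    rw [B.lintegral_law_of_childless w hi hφm.ennreal_ofReal]
    refine (lintegral_mono fun x => ?_).trans (hB w G i)
    simp only [nodeLlr_update_self]
    exact B.fam.lintegral_llr_add_exp_neg_le_Delta (B.η_mem w G i _) (B.η₀_mem w)
  have hE : ∫⁻ x, ENNReal.ofReal (Real.exp (-B.nodeLlr w G i x)) ∂B.law w G = 1 := by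
    rw [B.lintegral_law_of_childless w hi hem.ennreal_ofReal]
    simp only [nodeLlr_update_self, ← B.fam.llr_swap (B.η₀ w)]
    simp [B.fam.lintegral_exp_llr (B.η₀_mem w)]
  have hφi : Integrable (fun x => B.nodeLlr w G i x + Real.exp (-B.nodeLlr w G i x) - 1)
      (B.law w G) :=
    (lintegral_ofReal_ne_top_iff_integrable hφm.aestronglyMeasurable
      (ae_of_all _ fun x => Real.add_exp_neg_sub_one_nonneg _)).mp
      (hφle.trans_lt ENNReal.ofReal_lt_top).ne
  have hEi : Integrable (fun x => Real.exp (-B.nodeLlr w G i x)) (B.law w G) :=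
    (lintegral_ofReal_ne_top_iff_integrable hem.aestronglyMeasurable
      (ae_of_all _ fun x => (Real.exp_pos _).le)).mp (hE.trans_ne ENNReal.one_ne_top)
  have hEv : ∫ x, Real.exp (-B.nodeLlr w G i x) ∂B.law w G = 1 := by
    rw [integral_eq_lintegral_of_nonneg_ae (ae_of_all _ fun x => (Real.exp_pos _).le)
      hem.aestronglyMeasurable, hE, ENNReal.toReal_one]
  have hli : Integrable (B.nodeLlr w G i) (B.law w G) := by
    refine ((hφi.sub hEi).add (integrable_const 1)).congr (ae_of_all _ fun x => ?_)
    simp only [Pi.add_apply, Pi.sub_apply]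
    ring
  refine ⟨hli, ?_⟩
  have hφv : ∫ x, (B.nodeLlr w G i x + Real.exp (-B.nodeLlr w G i x) - 1) ∂B.law w G ≤ Δmax := by
    rw [integral_eq_lintegral_of_nonneg_ae
      (ae_of_all _ fun x => Real.add_exp_neg_sub_one_nonneg _) hφm.aestronglyMeasurable]
    exact ENNReal.toReal_le_of_le_ofReal hΔ hφle
  have hsum : Integrable (fun x => B.nodeLlr w G i x + Real.exp (-B.nodeLlr w G i x))
      (B.law w G) := hli.add hEi
  rw [integral_sub hsum (integrable_const _), integral_add hli hEi, hEv] at hφv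
  simpa using hφv

variable {w} {B} in
-- Only nodes with parents cost `Δmax`, whence the factor `s.card` instead of `m`.
theorem integrable_sum_nodeLlr_and_integral_le {Δmax : ℝ} (hΔ : 0 ≤ Δmax)
    (hB : B.DeltaBound Δmax) (hG : G.1.IsFlat) {s : Finset (Fin m)}
    (hs : ∀ u v, G.1.Adj u v → v ∈ s) :
    Integrable (fun x => ∑ i, B.nodeLlr w G i x) (B.law w G) ∧
      ∫ x, ∑ i, B.nodeLlr w G i x ∂B.law w G ≤ s.card * Δmax := by
  have h : ∀ i, Integrable (B.nodeLlr w G i) (B.law w G) ∧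
      ∫ x, B.nodeLlr w G i x ∂B.law w G ≤ if i ∈ s then Δmax else 0 := by
    intro i
    by_cases hi : ∃ u, G.1.Adj u i
    · obtain ⟨u, hu⟩ := hi
      rw [if_pos (hs u i hu)]
      exact integrable_nodeLlr_and_integral_le hΔ hB hG fun v => hG u i v hu
    · have h0 : B.nodeLlr w G i = fun _ => 0 :=
        funext (B.nodeLlr_eq_zero w G (not_exists.mp hi))
      rw [h0]
      refine ⟨integrable_zero _ _ _, ?_⟩
      rw [integral_zero]
      split_ifs <;> simp [hΔ]
  refine ⟨integrable_finsetSum _ fun i _ => (h i).1, ?_⟩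
  rw [integral_finsetSum _ fun i _ => (h i).1]
  refine (Finset.sum_le_sum fun i _ => (h i).2).trans_eq ?_
  simp

/-- The log-likelihood ratio of a data set, with respect to the network without edges. -/
noncomputable def dataLlr (n : ℕ) (w : W) (G : 𝒢) (S : Fin n → Fin m → 𝒳) : ℝ :=
  ∑ j, ∑ i, B.nodeLlr w G i (S j)

theorem measurable_dataLlr (n : ℕ) (w : W) (G : 𝒢) : Measurable (B.dataLlr n w G) :=
  Finset.measurable_fun_sum _ fun j _ => Finset.measurable_fun_sum _ fun i _ =>
    (B.measurable_nodeLlr w G i).comp (measurable_pi_apply j)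

theorem isProbabilityMeasure_dataLaw (n : ℕ) (hG : G.1.IsFlat) :
    IsProbabilityMeasure (B.dataLaw n w G) := by
  have := B.isProbabilityMeasure_law w hG
  unfold dataLaw
  infer_instance

theorem dataLaw_eq_withDensity (n : ℕ) (hG : G.1.IsFlat) :
    B.dataLaw n w G = (Measure.pi fun _ : Fin n => B.emptyLaw w).withDensity
      fun S => ENNReal.ofReal (Real.exp (B.dataLlr n w G S)) := by
  have hprob := B.isProbabilityMeasure_law w hG
  have hD : ∀ _ : Fin n, Measurable fun x => ∏ i, ENNReal.ofReal (Real.exp (B.nodeLlr w G i x)) :=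
    fun _ => Finset.measurable_fun_prod _ fun j _ => B.measurable_exp_nodeLlr w G j
  refine (Measure.pi_eq_withDensity (μ := fun _ => B.emptyLaw w) hD
    fun _ => B.law_eq_withDensity w G).trans ?_
  congr 1
  funext S
  simp only [dataLlr, Real.exp_sum]
  rw [ENNReal.ofReal_prod_of_nonneg fun j _ => Finset.prod_nonneg fun i _ => (Real.exp_pos _).le]
  refine Finset.prod_congr rfl fun j _ => ?_
  rw [ENNReal.ofReal_prod_of_nonneg fun i _ => (Real.exp_pos _).le]

variable {w} {B} in
theorem integrable_dataLlr_and_integral_le (n : ℕ) {Δmax : ℝ} (hΔ : 0 ≤ Δmax)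
    (hB : B.DeltaBound Δmax) (hG : G.1.IsFlat) {s : Finset (Fin m)}
    (hs : ∀ u v, G.1.Adj u v → v ∈ s) :
    Integrable (B.dataLlr n w G) (B.dataLaw n w G) ∧
      ∫ S, B.dataLlr n w G S ∂B.dataLaw n w G ≤ n * (s.card * Δmax) := by
  have := B.isProbabilityMeasure_law w hG
  obtain ⟨hi, hle⟩ := integrable_sum_nodeLlr_and_integral_le (w := w) hΔ hB hG hs
  have hmp : ∀ j : Fin n, MeasurePreserving (Function.eval j) (B.dataLaw n w G) (B.law w G) :=
    fun j => measurePreserving_eval (fun _ : Fin n => B.law w G) j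
  have hij : ∀ j : Fin n, Integrable (fun S => ∑ i, B.nodeLlr w G i (S j)) (B.dataLaw n w G) :=
    fun j => (hmp j).integrable_comp_of_integrable hi
  refine ⟨integrable_finsetSum _ fun j _ => hij j, ?_⟩
  simp only [dataLlr]
  rw [integral_finsetSum _ fun j _ => hij j]
  have hv : ∀ j : Fin n, ∫ S, ∑ i, B.nodeLlr w G i (S j) ∂B.dataLaw n w G ≤ s.card * Δmax := by
    intro j
    have hmap := integral_map (hmp j).measurable.aemeasurable
      (hi.aestronglyMeasurable.mono_ac (hmp j).map_eq.le.absolutelyContinuous)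
    rw [(hmp j).map_eq] at hmap
    exact hmap.symm.trans_le hle
  refine (Finset.sum_le_sum fun j _ => hv j).trans_eq ?_
  simp

end BNFamily

/-! ### From ensembles to necessary sample sizes. -/

theorem DAG.MarkovEquiv.refl {m : ℕ} (G : DAG m) : G.MarkovEquiv G := fun _ _ _ _ _ _ => Iff.rfl

theorem DAG.MarkovEquiv.symm {m : ℕ} {G₁ G₂ : DAG m} (h : G₁.MarkovEquiv G₂) :
    G₂.MarkovEquiv G₁ := fun A B C hAB hAC hBC => (h A B C hAB hAC hBC).symm

theorem DAG.MarkovEquiv.trans {m : ℕ} {G₁ G₂ G₃ : DAG m} (h : G₁.MarkovEquiv G₂)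
    (h' : G₂.MarkovEquiv G₃) : G₁.MarkovEquiv G₃ :=
  fun A B C hAB hAC hBC => (h A B C hAB hAC hBC).trans (h' A B C hAB hAC hBC)

theorem IsNecessary.mono {m : ℕ} {𝒢 : Set (DAG m)} {L L' : ℝ → ℝ} (h : IsNecessary.{u, v} 𝒢 L)
    (hL : ∀ Δmax, 0 < Δmax → L' Δmax ≤ L Δmax) : IsNecessary.{u, v} 𝒢 L' := by
  obtain ⟨𝒢', h𝒢', H⟩ := h
  exact ⟨𝒢', h𝒢', fun 𝒳 _ W _ _ _ d B Δmax n hΔ hB hn =>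
    H 𝒳 W d B Δmax n hΔ hB (hn.trans (hL Δmax hΔ))⟩

/-- Vacuous: no sample size is below a negative bound. This disposes of the degenerate values of `m`
and `k`. -/
theorem isNecessary_of_neg {m : ℕ} {𝒢 : Set (DAG m)} (h𝒢 : 𝒢.Nonempty) {L : ℝ → ℝ}
    (hL : ∀ Δmax, 0 < Δmax → L Δmax < 0) : IsNecessary.{u, v} 𝒢 L := by
  obtain ⟨G, hG⟩ := h𝒢
  refine ⟨{⟨G, hG⟩}, Finset.singleton_nonempty _, fun 𝒳 _ W _ _ _ d B Δmax n hΔ _ hn => ?_⟩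
  exact absurd ((Nat.cast_nonneg n).trans hn) (not_le.mpr (hL Δmax hΔ))

/-- A lower bound for the error of any decoder on an ensemble of pairwise inequivalent flat
graphs. The decoder need not be measurable. -/
theorem BNFamily.half_le_sum_dataLaw {m : ℕ} {𝒢 : Set (DAG m)} {𝒳 : Type*} [MeasurableSpace 𝒳]
    {W : Type*} {d : ℕ} (B : BNFamily 𝒢 𝒳 W d) (w : W) {ι : Type*} [Fintype ι] [Nonempty ι]
    {g : ι → 𝒢} (hflat : ∀ i, (g i).1.IsFlat) {s : Finset (Fin m)}
    (hs : ∀ i u v, (g i).1.Adj u v → v ∈ s)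
    (hinj : ∀ i j, (g i).1.MarkovEquiv (g j).1 → i = j) {Δmax : ℝ} (hΔ : 0 ≤ Δmax)
    (hB : B.DeltaBound Δmax) {n : ℕ}
    (hn : n * (s.card * Δmax) ≤ Real.log (Fintype.card ι) / 2 - Real.log 2)
    (dec : (Fin n → Fin m → 𝒳) → 𝒢) :
    1 / 2 ≤ ∑ i, (Fintype.card ι : ℝ≥0∞)⁻¹ *
      B.dataLaw n w (g i) {S | ¬ (dec S).1.MarkovEquiv (g i).1} := by
  have hprob : ∀ i, IsProbabilityMeasure (B.dataLaw n w (g i)) :=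
    fun i => B.isProbabilityMeasure_dataLaw w n (hflat i)
  -- The error events may be nonmeasurable, so they are replaced by measurable hulls of equal
  -- measure. The complements of the hulls lie in the regions of correct decoding, which are
  -- disjoint because the graphs are inequivalent.
  set E : ι → Set (Fin n → Fin m → 𝒳) := fun i =>
    toMeasurable (B.dataLaw n w (g i)) {S | ¬ (dec S).1.MarkovEquiv (g i).1} with hE
  have hEm : ∀ i, MeasurableSet (E i) := fun i => measurableSet_toMeasurable _ _
  have hdec : ∀ i, ∀ S ∈ (E i)ᶜ, (dec S).1.MarkovEquiv (g i).1 := fun i S hS =>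
    not_not.mp fun h => hS (subset_toMeasurable _ _ h)
  have hdisj : Pairwise (Function.onFun Disjoint fun i => (E i)ᶜ) := fun i j hij =>
    Set.disjoint_left.mpr fun S hi hj => hij (hinj i j ((hdec i S hi).symm.trans (hdec j S hj)))
  have hfano := sum_measureReal_le_of_integral_llr_le
    (fun i => B.measurable_dataLlr n w (g i))
    (fun i => B.dataLaw_eq_withDensity w n (hflat i))
    (fun i => (integrable_dataLlr_and_integral_le n hΔ hB (hflat i) (hs i)).1)
    (by positivity : 0 ≤ n * (s.card * Δmax))
    (fun i => (integrable_dataLlr_and_integral_le n hΔ hB (hflat i) (hs i)).2)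
    hn (fun i => (hEm i).compl) hdisj
  have hbad : ∀ i, B.dataLaw n w (g i) {S | ¬ (dec S).1.MarkovEquiv (g i).1} =
      ENNReal.ofReal (1 - (B.dataLaw n w (g i)).real (E i)ᶜ) := by
    intro i
    rw [← measure_toMeasurable, probReal_compl_eq_one_sub (hEm i), sub_sub_cancel,
      ofReal_measureReal]
  have hN : (0 : ℝ) < Fintype.card ι := by exact_mod_cast Fintype.card_pos
  simp only [hbad]
  rw [← Finset.mul_sum, ← ENNReal.ofReal_sum_of_nonneg
    fun i _ => sub_nonneg.mpr measureReal_le_one, Finset.sum_sub_distrib]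
  calc (1 / 2 : ℝ≥0∞) = (Fintype.card ι : ℝ≥0∞)⁻¹ * ENNReal.ofReal (Fintype.card ι / 2) := by
        rw [ENNReal.ofReal_div_of_pos two_pos, ENNReal.ofReal_natCast, div_eq_mul_inv,
          div_eq_mul_inv, ← mul_assoc, ENNReal.inv_mul_cancel (by simp) (by simp)]
        simp
    _ ≤ _ := by
        gcongr
        simp only [Finset.sum_const, Finset.card_univ, nsmul_eq_mul, mul_one]
        linarith

theorem isNecessary_of_ensemble {m : ℕ} {𝒢 : Set (DAG m)} {ι : Type*} [Fintype ι] [Nonempty ι]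
    (g : ι → 𝒢) (hflat : ∀ i, (g i).1.IsFlat) {s : Finset (Fin m)}
    (hs : ∀ i u v, (g i).1.Adj u v → v ∈ s)
    (hinj : ∀ i j, (g i).1.MarkovEquiv (g j).1 → i = j) {L : ℝ → ℝ}
    (hL : ∀ Δmax, 0 < Δmax →
      L Δmax * (s.card * Δmax) ≤ Real.log (Fintype.card ι) / 2 - Real.log 2) :
    IsNecessary.{u, v} 𝒢 L := by
  have hg : Function.Injective g := fun i j hij =>
    hinj i j (hij ▸ DAG.MarkovEquiv.refl (g i).1)
  refine ⟨Finset.univ.map ⟨g, hg⟩, Finset.univ_nonempty.map,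
    fun 𝒳 _ W _ _ _ d B Δmax n hΔ hB hn => ?_⟩
  obtain ⟨w⟩ := ‹Nonempty W›
  -- The supremum over priors is at least its value at a point mass, and the Fano bound holds for
  -- every single parameter map.
  refine le_iInf fun dec => le_iSup₂_of_le (Measure.dirac w) inferInstance ?_
  simp only [lintegral_dirac]
  have hn' : n * (s.card * Δmax) ≤ Real.log (Fintype.card ι) / 2 - Real.log 2 :=
    (mul_le_mul_of_nonneg_right hn (by positivity)).trans (hL Δmax hΔ)
  refine (B.half_le_sum_dataLaw w hflat hs hinj hΔ.le hB hn' dec).trans ?_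
  rw [← tsum_fintype (L := SummationFilter.unconditional _)]
  -- The ensemble is a subfamily of the class, and the remaining terms of the sum are nonnegative.
  refine le_of_eq_of_le ?_ (ENNReal.tsum_comp_le_tsum_of_injective hg _)
  refine tsum_congr fun i => ?_
  have hmem : g i ∈ Finset.univ.map ⟨g, hg⟩ := Finset.mem_map_of_mem ⟨g, hg⟩ (Finset.mem_univ i)
  rw [PMF.uniformOfFinset_apply_of_mem _ hmem, Finset.card_map, Finset.card_univ]

/-! ## Flat graphs with two sinks -/

theorem DAG.not_dSep_of_adj {m : ℕ} {G : DAG m} {u v : Fin m} (h : G.Adj u v) :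
    ¬ G.DSep {u} {v} ∅ := by
  intro hsep
  have huv : u ≠ v := by
    rintro rfl
    exact G.not_adj_self u h
  refine hsep u rfl v rfl [u, v] rfl rfl ⟨by simpa using huv, by simpa using Or.inl h⟩ ?_
  intro a b c habc
  have := habc.length_le
  simp at this

/-- A longer trail from the parentless `u` starts with an edge `u → y`. By flatness `y` has no
child, so the next edge also points into `y`: a collider, which blocks when nothing is conditioned
on. -/
theorem DAG.IsFlat.dSep {m : ℕ} {G : DAG m} (hG : G.IsFlat) {u v : Fin m} (huv : u ≠ v)
    (hu : ∀ w, ¬ G.Adj w u) (h : ¬ G.Adj u v) : G.DSep {u} {v} ∅ := by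
  rintro a rfl b rfl l hhead hlast ⟨_, hchain⟩ hact
  match l with
  | [] => simp at hhead
  | [x] =>
    simp only [List.head?_cons, Option.some.injEq, List.getLast?_singleton] at hhead hlast
    exact huv (hhead.symm.trans hlast)
  | [x, y] =>
    simp only [List.head?_cons, Option.some.injEq] at hhead
    simp at hlast hchain
    subst hhead hlast
    exact hchain.elim h (hu _)
  | x :: y :: z :: l =>
    simp only [List.head?_cons, Option.some.injEq] at hhead
    subst hhead
    simp only [List.isChain_cons_cons] at hchain
    have hxy : G.Adj x y := hchain.1.resolve_right (hu y)
    have hzy : G.Adj z y := hchain.2.1.resolve_left (hG x y z hxy)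
    obtain ⟨c, hc, -⟩ := (hact x y z ⟨[], l, by simp⟩).1 ⟨hxy, hzy⟩
    exact hc

/-- The graph on `n + 2` nodes in which the first two nodes have the parent sets `S 0` and `S 1`
among the other nodes. -/
def twoSinkDAG {n : ℕ} (S : Fin 2 → Finset (Fin n)) : DAG (n + 2) where
  Adj u v := ∃ (s : Fin 2) (j : Fin n), j ∈ S s ∧ u = j.addNat 2 ∧ v = Fin.castLE (by omega) s
  acyclic v hv := by
    -- The first edge of a closed walk at `v` makes `v` at least `2`, the last one makes it less
    -- than `2`.
    obtain ⟨w, ⟨s, j, -, h, -⟩, -⟩ := Relation.TransGen.head'_iff.mp hv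
    obtain ⟨w', -, ⟨s', j', -, -, h'⟩⟩ := Relation.TransGen.tail'_iff.mp hv
    have h1 := congrArg Fin.val h
    have h2 := congrArg Fin.val h'
    simp at h1 h2
    omega

theorem castLE_ne_addNat {n : ℕ} (s : Fin 2) (j : Fin n) :
    Fin.castLE (show 2 ≤ n + 2 by omega) s ≠ j.addNat 2 := by
  intro h
  have := congrArg Fin.val h
  simp at this
  omega

theorem twoSinkDAG_adj {n : ℕ} {S : Fin 2 → Finset (Fin n)} {s : Fin 2} {j : Fin n} :
    (twoSinkDAG S).Adj (j.addNat 2) (Fin.castLE (by omega) s) ↔ j ∈ S s := by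
  constructor
  · rintro ⟨s', j', hj, h1, h2⟩
    rw [Fin.addNat_inj] at h1
    rw [Fin.castLE_inj] at h2
    rwa [h1, h2]
  · exact fun h => ⟨s, j, h, rfl, rfl⟩

theorem isFlat_twoSinkDAG {n : ℕ} (S : Fin 2 → Finset (Fin n)) : (twoSinkDAG S).IsFlat := by
  rintro u v w ⟨s, j, -, -, rfl⟩ ⟨s', j', -, h, -⟩
  exact castLE_ne_addNat s j' h

theorem subset_of_markovEquiv_twoSinkDAG {n : ℕ} {S S' : Fin 2 → Finset (Fin n)}
    (h : (twoSinkDAG S).MarkovEquiv (twoSinkDAG S')) (s : Fin 2) : S s ⊆ S' s := by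
  intro j hj
  by_contra hj'
  have hne := (castLE_ne_addNat s j).symm
  refine DAG.not_dSep_of_adj (twoSinkDAG_adj.mpr hj)
    ((h _ _ ∅ (by simpa using hne) (by simp) (by simp)).mpr ?_)
  refine (isFlat_twoSinkDAG S').dSep hne ?_ (mt twoSinkDAG_adj.mp hj')
  rintro w ⟨s', j', -, -, hs'⟩
  exact castLE_ne_addNat s' j hs'.symm

theorem eq_of_markovEquiv_twoSinkDAG {n : ℕ} {S S' : Fin 2 → Finset (Fin n)}
    (h : (twoSinkDAG S).MarkovEquiv (twoSinkDAG S')) : S = S' :=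
  funext fun s => (subset_of_markovEquiv_twoSinkDAG h s).antisymm
    (subset_of_markovEquiv_twoSinkDAG h.symm s)

theorem twoSinkDAG_mem_sparseDAGs {n k : ℕ} {S : Fin 2 → Finset (Fin n)}
    (hS : ∀ s, (S s).card ≤ k) : twoSinkDAG S ∈ sparseDAGs (n + 2) k := by
  intro i
  by_cases hi : ∃ s : Fin 2, i = Fin.castLE (by omega) s
  · obtain ⟨s, rfl⟩ := hi
    have hsub : (twoSinkDAG S).parents (Fin.castLE (by omega) s) ⊆
        ((S s).image fun j => j.addNat 2 : Finset (Fin (n + 2))) := by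
      rintro u ⟨s', j, hj, rfl, h⟩
      rw [Fin.castLE_inj] at h
      subst h
      exact_mod_cast Finset.mem_image_of_mem _ hj
    calc _ ≤ _ := Set.ncard_le_ncard hsub (Finset.finite_toSet _)
      _ = _ := Set.ncard_coe_finset _
      _ ≤ _ := Finset.card_image_le
      _ ≤ k := hS s
  · have : (twoSinkDAG S).parents i = ∅ :=
      Set.eq_empty_of_forall_notMem fun u ⟨s, _, _, _, h⟩ => hi ⟨s, h⟩
    simp [this]

/-! ### Counting parent sets of bounded size. -/

/-- The number of subsets of size at most `k` of a set with `n` elements. -/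
def sumChoose (n k : ℕ) : ℕ := ∑ j ∈ Finset.range (k + 1), n.choose j

theorem card_subtype_card_le (n k : ℕ) :
    Fintype.card {S : Finset (Fin n) // S.card ≤ k} = sumChoose n k := by
  rw [sumChoose, Fintype.card_subtype, Finset.card_eq_sum_card_fiberwise (f := Finset.card)
    (t := Finset.range (k + 1)) fun S hS => by simpa [Nat.lt_succ_iff] using hS]
  refine Finset.sum_congr rfl fun j hj => ?_
  have hc := Finset.card_powersetCard j (Finset.univ : Finset (Fin n))
  rw [Finset.card_univ, Fintype.card_fin] at hc
  rw [Finset.filter_filter, ← hc]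
  congr 1
  ext S
  simp only [Finset.mem_filter, Finset.mem_univ, true_and, Finset.mem_powersetCard,
    Finset.subset_univ]
  have := Finset.mem_range.mp hj
  omega

/-- The ensemble has `sumChoose n k ^ 2` members, so the `1 / 2` in Fano's condition cancels the
square. A second sink doubles both the divergence and the log-cardinality, which halves the loss
`log 2` per sink. -/
theorem isNecessary_of_twoSink {n k : ℕ} {𝒢 : Set (DAG (n + 2))}
    (h𝒢 : sparseDAGs (n + 2) k ⊆ 𝒢) {L : ℝ → ℝ}
    (hL : ∀ Δmax, 0 < Δmax → L Δmax * (2 * Δmax) ≤ Real.log (sumChoose n k) - Real.log 2) :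
    IsNecessary.{u, v} 𝒢 L := by
  have : Nonempty {S : Finset (Fin n) // S.card ≤ k} := ⟨⟨∅, by simp⟩⟩
  let g : (Fin 2 → {S : Finset (Fin n) // S.card ≤ k}) → 𝒢 := fun S =>
    ⟨twoSinkDAG fun s => (S s).1, h𝒢 (twoSinkDAG_mem_sparseDAGs fun s => (S s).2)⟩
  refine isNecessary_of_ensemble g (s := Finset.univ.image (Fin.castLE (by omega : 2 ≤ n + 2)))
    (fun S => isFlat_twoSinkDAG _) ?_ ?_ fun Δmax hΔ => ?_
  · rintro S u v ⟨s, j, -, -, rfl⟩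
    exact Finset.mem_image_of_mem _ (Finset.mem_univ s)
  · intro S S' h
    have := eq_of_markovEquiv_twoSinkDAG h
    exact funext fun s => Subtype.ext (congrFun this s)
  · rw [Finset.card_image_of_injective _ (Fin.castLE_injective _), Fintype.card_fun,
      card_subtype_card_le]
    simpa using hL Δmax hΔ

theorem one_le_sumChoose (n k : ℕ) : 1 ≤ sumChoose n k := by
  have h := Finset.single_le_sum (f := fun j => n.choose j) (fun _ _ => Nat.zero_le _)
    (Finset.mem_range.mpr (Nat.succ_pos k))
  simpa [sumChoose] using h

theorem choose_le_sumChoose (n k : ℕ) : n.choose k ≤ sumChoose n k :=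
  Finset.single_le_sum (f := fun j => n.choose j) (fun _ _ => Nat.zero_le _)
    (Finset.mem_range.mpr (Nat.lt_succ_self k))

theorem sumChoose_of_le {n k : ℕ} (h : n ≤ k) : sumChoose n k = 2 ^ n := by
  rw [← Nat.sum_range_choose, sumChoose]
  refine (Finset.sum_subset (Finset.range_subset_range.mpr (by omega)) fun _ _ hj => ?_).symm
  exact Nat.choose_eq_zero_of_lt (by simpa using hj)

theorem two_pow_le_two_mul_sumChoose {n k : ℕ} (h : n ≤ 2 * k) : 2 ^ n ≤ 2 * sumChoose n k := by
  rcases le_total n k with hnk | hkn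
  · rw [sumChoose_of_le hnk]
    omega
  · have hr : sumChoose n k = ∑ j ∈ Finset.Ico (n - k) (n + 1), n.choose j := by
      have h := Finset.sum_Ico_reflect (fun j => n.choose j) 0 (by omega : k + 1 ≤ n + 1)
      rw [show n + 1 - (k + 1) = n - k by omega, Nat.sub_zero, Nat.Ico_zero_eq_range] at h
      rw [← h, sumChoose]
      refine Finset.sum_congr rfl fun j hj => (Nat.choose_symm ?_).symm
      have := Finset.mem_range.mp hj
      omega
    have hle : ∑ j ∈ Finset.Ico (k + 1) (n + 1), n.choose j ≤ sumChoose n k := by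
      rw [hr]
      exact Finset.sum_le_sum_of_subset (Finset.Ico_subset_Ico_left (by omega))
    rw [← Nat.sum_range_choose, ← Finset.sum_range_add_sum_Ico _ (by omega : k + 1 ≤ n + 1)]
    change sumChoose n k + _ ≤ _
    omega

theorem div_pow_le_choose {n k : ℕ} (h : k ≤ n) : ((n : ℝ) / k) ^ k ≤ n.choose k := by
  induction k generalizing n with
  | zero => simp
  | succ k ih =>
    obtain ⟨n, rfl⟩ : ∃ n', n = n' + 1 := ⟨n - 1, by omega⟩
    have hkn : k ≤ n := by omega
    have hc : ((n + 1 : ℕ) : ℝ) / ((k + 1 : ℕ) : ℝ) * n.choose k = (n + 1).choose (k + 1) := by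
      have := Nat.add_one_mul_choose_eq n k
      have : ((n + 1 : ℕ) : ℝ) * n.choose k = (n + 1).choose (k + 1) * ((k + 1 : ℕ) : ℝ) := by
        exact_mod_cast this
      rw [div_mul_eq_mul_div, this, mul_div_assoc, div_self (by positivity), mul_one]
    rw [pow_succ', ← hc]
    gcongr
    rcases Nat.eq_zero_or_pos k with rfl | hk
    -- The comparison `(n + 1) / (k + 1) ≤ n / k` used below can fail for `k = 0`, where `n / 0 =
    -- 0`.
    · simp
    refine le_trans ?_ (ih hkn)
    gcongr ?_ ^ k
    rw [div_le_div_iff₀ (by positivity) (by positivity)]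
    have : (k : ℝ) ≤ n := by exact_mod_cast hkn
    push_cast
    linarith

theorem mul_log_div_le_log_sumChoose {n k : ℕ} (hn : 0 < n) (hk : 0 < k) :
    k * (Real.log n - Real.log k) ≤ Real.log (sumChoose n k) := by
  have hn' : (0 : ℝ) < n := by exact_mod_cast hn
  have hk' : (0 : ℝ) < k := by exact_mod_cast hk
  rw [← Real.log_div hn'.ne' hk'.ne', ← Real.log_pow]
  refine Real.log_le_log (by positivity) ?_
  rcases le_total k n with h | h
  · exact (div_pow_le_choose h).trans (by exact_mod_cast choose_le_sumChoose n k)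
  · refine (pow_le_one₀ (by positivity) ?_).trans (by exact_mod_cast one_le_sumChoose n k)
    rw [div_le_one hk']
    exact_mod_cast h

theorem mul_log_sub_le_log_factorial {k : ℕ} (hk : 0 < k) :
    k * Real.log k - k ≤ Real.log (k.factorial : ℝ) := by
  have hk' : (0 : ℝ) < k := by exact_mod_cast hk
  have h := Real.pow_div_factorial_le_exp (x := k) hk'.le k
  have hf : (0 : ℝ) < k.factorial := by exact_mod_cast k.factorial_pos
  have := Real.log_le_log (by positivity) h
  rw [Real.log_exp, Real.log_div (by positivity) hf.ne', Real.log_pow] at this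
  linarith

/-- This is the sparse bound multiplied by `m = n + 2`, with `log k!` replaced by `k log k - k`. The
regimes `n ≤ k`, `k < n ≤ 2 k` and `2 k < n` use different lower bounds for `sumChoose`. -/
theorem sparse_rate_le_log_sumChoose {n k : ℕ} (hn : 0 < n) (hk : 0 < k) (hkn : k ≤ n + 1) :
    k * (n * (Real.log n - Real.log k) - (n - k) + (k - 3) * Real.log 2 / 2) - Real.log 2 ≤
      (n + 2) * (Real.log (sumChoose n k) - Real.log 2) := by
  have hn' : (0 : ℝ) < n := by exact_mod_cast hn
  have hk' : (0 : ℝ) < k := by exact_mod_cast hk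
  have hk1 : (1 : ℝ) ≤ k := by exact_mod_cast hk
  have hM1 : (1 : ℝ) ≤ sumChoose n k := by exact_mod_cast one_le_sumChoose n k
  have hl1 := Real.log_two_gt_d9
  have hl2 := Real.log_two_lt_d9
  -- the logarithmic term is at most `n (n - k) / k`
  have hlog : k * (n * (Real.log n - Real.log k)) ≤ n * (n - k) := by
    have h := Real.log_le_sub_one_of_pos (div_pos hn' hk')
    rw [Real.log_div hn'.ne' hk'.ne'] at h
    have h2 : (k : ℝ) * (n / k - 1) = n - k := by field_simp
    nlinarith [mul_le_mul_of_nonneg_left h (mul_pos hn' hk').le]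
  rcases le_or_gt n k with hnk | hnk
  · rw [sumChoose_of_le hnk]
    push_cast
    rw [Real.log_pow]
    rcases hnk.eq_or_lt with rfl | hlt
    · have h1 : 0 ≤ Real.log 2 * ((n : ℝ) ^ 2 / 2 + 5 * n / 2 - 1) :=
        mul_nonneg (by linarith) (by nlinarith)
      simp only [sub_self, mul_zero]
      linarith
    · obtain rfl : k = n + 1 := by omega
      have hn1 : (1 : ℝ) ≤ n := by exact_mod_cast hn
      push_cast at hlog ⊢
      nlinarith [mul_nonneg (sub_nonneg.mpr hn1) hn'.le]
  have hnk' : (k : ℝ) + 1 ≤ n := by exact_mod_cast hnk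
  rcases le_or_gt n (2 * k) with h2 | h2
  · have h2' : (n : ℝ) ≤ 2 * k := by exact_mod_cast h2
    have hM : (n : ℝ) * Real.log 2 ≤ Real.log 2 + Real.log (sumChoose n k) := by
      rw [← Real.log_pow, ← Real.log_mul (by norm_num) (by positivity)]
      refine Real.log_le_log (by positivity) ?_
      exact_mod_cast two_pow_le_two_mul_sumChoose h2
    have h1 := mul_le_mul_of_nonneg_left hM (by positivity : (0 : ℝ) ≤ n + 2)
    have h3 : 0 ≤ Real.log 2 * ((k : ℝ) ^ 2 / 2 + (n - k) ^ 2 + 3 / 2 * k - 3) :=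
      mul_nonneg (by linarith) (by nlinarith)
    -- After `hlog` the left side contains `(n - k) ^ 2`. It is at most `k (n - k)`, hence at most
    -- `2 log 2` times that, since `2 log 2 > 1`.
    have h4 : ((n : ℝ) - k) * (n - k) ≤ k * (n - k) :=
      mul_le_mul_of_nonneg_right (by linarith) (by linarith)
    have h5 : 0 ≤ (2 * Real.log 2 - 1) * (k * (n - k)) :=
      mul_nonneg (by linarith) (mul_nonneg hk'.le (by linarith))
    linarith
  · have h2' : 2 * (k : ℝ) + 1 ≤ n := by exact_mod_cast h2
    -- Here `(n / k) ^ k` is used: the terms `k n log (n / k)` cancel exactly and leave `2 k log (n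
    -- / k) ≥ 2 k log 2`.
    have hM := mul_log_div_le_log_sumChoose hn hk
    have hlog2 : Real.log 2 ≤ Real.log n - Real.log k := by
      rw [← Real.log_div hn'.ne' hk'.ne']
      refine Real.log_le_log two_pos ?_
      rw [le_div_iff₀ hk']
      linarith
    have h1 := mul_le_mul_of_nonneg_left hM (by positivity : (0 : ℝ) ≤ n + 2)
    have h3 := mul_le_mul_of_nonneg_left hlog2 hk'.le
    have h4 : 0 ≤ ((n : ℝ) - 2 * k - 1) * (k - Real.log 2) :=
      mul_nonneg (by linarith) (by linarith)
    have h5 : 0 ≤ (1 - Real.log 2) * (k : ℝ) ^ 2 := mul_nonneg (by linarith) (by positivity)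
    have h6 : 0 ≤ Real.log 2 * ((k - 1) * (k + 3 : ℝ)) :=
      mul_nonneg (by linarith) (mul_nonneg (by linarith) (by linarith))
    have h7 : Real.log 2 * 1 ≤ Real.log 2 * k :=
      mul_le_mul_of_nonneg_left hk1 (by linarith)
    linarith

/-- After multiplication by `m`, the term `2 log (m - 2)` of `remainder` reduces the coefficient of
`k log n` from `n + 2` to `n`; the estimate `k! ≥ (k / e) ^ k` then reduces the claim to
`sparse_rate_le_log_sumChoose`. -/
theorem sparse_bound_le {n k : ℕ} (hn : 0 < n) (hk : 0 < k) (hkn : k ≤ n + 1) :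
    (k : ℝ) * Real.log (((n + 2 : ℕ) : ℝ) - 2) +
        (k : ℝ) * ((k : ℝ) - 3) * Real.log 2 / (2 * ((n + 2 : ℕ) : ℝ)) - remainder (n + 2) k ≤
      Real.log (sumChoose n k) - Real.log 2 := by
  have h := sparse_rate_le_log_sumChoose hn hk hkn
  have hf := mul_log_sub_le_log_factorial hk
  have hm0 : (0 : ℝ) < n + 2 := by positivity
  have hk' : (0 : ℝ) < k := by exact_mod_cast hk
  rw [remainder]
  push_cast
  rw [add_sub_cancel_right]
  refine le_of_mul_le_mul_left (le_trans ?_ h) hm0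
  have e : ((n : ℝ) + 2) * (k * Real.log n + k * (k - 3) * Real.log 2 / (2 * (n + 2)) -
      (k / (n + 2) * (n + 2 * Real.log n + Real.log k.factorial + (n + 2 - k - 2) * Real.log k) +
        Real.log 2 / (n + 2))) =
      k * (n * Real.log n - n - Real.log k.factorial - (n - k) * Real.log k +
        (k - 3) * Real.log 2 / 2) - Real.log 2 := by
    field_simp
    ring
  have := mul_le_mul_of_nonneg_left hf hk'.le
  rw [e]
  linarith

/-! ### The four sample-size bounds. -/

theorem isNecessary_allDAGs (m : ℕ) : IsNecessary.{u, v} (allDAGs m)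
    (fun Δmax => Real.log 2 / Δmax * (((m : ℝ) - 3) / 2 - 1 / (m : ℝ))) := by
  have hlog2 : 0 < Real.log 2 := Real.log_pos one_lt_two
  -- Two sinks need `m ≥ 2`. Below that the bound is negative, also for `m = 0`, where `1 / m` is
  -- read as `0`.
  rcases lt_or_ge m 2 with hm | hm
  · have hempty : ∀ v : Fin m, ¬ Relation.TransGen (fun _ _ => False) v v := fun v hv => by
      obtain ⟨w, h, -⟩ := Relation.TransGen.head'_iff.mp hv
      exact h
    refine isNecessary_of_neg ⟨⟨_, hempty⟩, Set.mem_univ _⟩ fun Δmax hΔ => ?_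
    have hm' : (m : ℝ) ≤ 1 := by exact_mod_cast Nat.lt_succ_iff.mp hm
    have : (0 : ℝ) ≤ 1 / m := by positivity
    exact mul_neg_of_pos_of_neg (by positivity) (by linarith)
  · obtain ⟨n, rfl⟩ : ∃ n, m = n + 2 := ⟨m - 2, by omega⟩
    -- With `k = n` every parent set is allowed, and `log (sumChoose n n) = n log 2`.
    refine isNecessary_of_twoSink (k := n) (Set.subset_univ _) fun Δmax hΔ => ?_
    rw [sumChoose_of_le le_rfl]
    push_cast
    rw [Real.log_pow]
    have h1 : (0 : ℝ) ≤ Real.log 2 * (1 / (n + 2)) := by positivity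
    have e : Real.log 2 / Δmax * (((n : ℝ) + 2 - 3) / 2 - 1 / (n + 2)) * (2 * Δmax) =
        (n - 1) * Real.log 2 - 2 * (Real.log 2 * (1 / (n + 2))) := by
      field_simp
      ring
    rw [e]
    linarith

theorem isNecessary_sparseDAGs {m k : ℕ} (hm : 2 < m) (hkm : k < m) :
    IsNecessary.{u, v} (sparseDAGs m k)
      (fun Δmax => 1 / (2 * Δmax) *
        ((k : ℝ) * Real.log ((m : ℝ) - 2) + (k : ℝ) * ((k : ℝ) - 3) * Real.log 2 / (2 * (m : ℝ))
          - remainder m k)) := by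
  have hlog2 : 0 < Real.log 2 := Real.log_pos one_lt_two
  obtain ⟨n, rfl⟩ : ∃ n, m = n + 2 := ⟨m - 2, by omega⟩
  rcases Nat.eq_zero_or_pos k with rfl | hk
  · refine isNecessary_of_neg
      ⟨_, twoSinkDAG_mem_sparseDAGs (n := n) (k := 0) (S := fun _ => ∅) (by simp)⟩
      fun Δmax hΔ => ?_
    -- For `k = 0` only `-log 2 / m` survives in the bracket.
    refine mul_neg_of_pos_of_neg (by positivity) ?_
    have : 0 < Real.log 2 / ((n : ℝ) + 2) := by positivity
    simpa [remainder] using this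
  · refine isNecessary_of_twoSink subset_rfl fun Δmax hΔ => ?_
    refine le_of_eq_of_le ?_ (sparse_bound_le (by omega) hk (by omega))
    field_simp

theorem isNecessary_allDAGs_linear {m : ℕ} (hm : 12 ≤ m) :
    IsNecessary.{u, v} (allDAGs m) (fun Δmax => Real.log 2 / 6 * (m : ℝ) / Δmax) := by
  have hlog2 : 0 < Real.log 2 := Real.log_pos one_lt_two
  refine (isNecessary_allDAGs m).mono fun Δmax hΔ => ?_
  have hm' : (12 : ℝ) ≤ m := by exact_mod_cast hm
  have h1 : 1 / (m : ℝ) ≤ 1 / 12 := one_div_le_one_div_of_le (by norm_num) hm'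
  rw [show Real.log 2 / 6 * m / Δmax = Real.log 2 / Δmax * (m / 6) by ring]
  gcongr
  linarith

theorem exists_isNecessary_sparseDAGs {a : ℝ} (ha1 : a < 1) :
    ∃ c : ℝ, 0 < c ∧ ∃ m₀ : ℕ, ∀ m k : ℕ, m₀ ≤ m → 1 ≤ k → (k : ℝ) ≤ (m : ℝ) ^ a →
      IsNecessary.{u, v} (sparseDAGs m k)
        (fun Δmax => c * ((k : ℝ) * Real.log (m : ℝ) + (k : ℝ) ^ 2 / (m : ℝ)) / Δmax) := by
  have hlog2 : 0 < Real.log 2 := Real.log_pos one_lt_two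
  have ha' : 0 < 1 - a := by linarith
  obtain ⟨m₀, hm₀⟩ := Filter.eventually_atTop.mp
    ((Real.tendsto_log_atTop.comp tendsto_natCast_atTop_atTop).eventually_ge_atTop
      (4 * Real.log 2 / (1 - a)))
  -- As `k ^ 2 / m ≤ k log m`, the claimed rate times `2 Δmax` is at most `(1 - a) / 2 * k log m`.
  -- The ensemble supplies `(1 - a) k log m - k log 2 - log 2`, and the choice of `m₀` lets half of
  -- its main term absorb `2 k log 2`.
  refine ⟨(1 - a) / 8, by positivity, max m₀ 4, fun m k hm hk hka => ?_⟩
  have hlogm : 4 * Real.log 2 ≤ (1 - a) * Real.log m := by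
    have := hm₀ m ((le_max_left _ _).trans hm)
    rw [div_le_iff₀ ha'] at this
    simpa [mul_comm] using this
  have hm4 : 4 ≤ m := (le_max_right _ _).trans hm
  obtain ⟨n, rfl⟩ : ∃ n, m = n + 2 := ⟨m - 2, by omega⟩
  have hn : 2 ≤ n := by omega
  have hn' : (2 : ℝ) ≤ n := by exact_mod_cast hn
  have hk1 : (1 : ℝ) ≤ k := by exact_mod_cast hk
  refine isNecessary_of_twoSink subset_rfl fun Δmax hΔ => ?_
  have hM := mul_log_div_le_log_sumChoose (by omega : 0 < n) hk
  refine le_trans ?_ (sub_le_sub_right hM _)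
  push_cast at hka hlogm ⊢
  set ℓ := Real.log ((n : ℝ) + 2) with hℓ
  have hlogn : ℓ - Real.log 2 ≤ Real.log n := by
    rw [hℓ, ← Real.log_div (by positivity) two_ne_zero]
    exact Real.log_le_log (by positivity) (by linarith)
  have hlogk : Real.log k ≤ a * ℓ := by
    rw [hℓ, ← Real.log_rpow (by positivity)]
    exact Real.log_le_log (by positivity) hka
  have hℓ1 : 1 ≤ ℓ := by
    have h4 : 2 * Real.log 2 ≤ ℓ := by
      rw [hℓ, show 2 * Real.log 2 = Real.log (2 ^ 2) by rw [Real.log_pow]; norm_num]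
      exact Real.log_le_log (by norm_num) (by linarith)
    linarith [Real.log_two_gt_d9]
  have hkm : (k : ℝ) ^ 2 / (n + 2) ≤ k * ℓ := by
    have hkle : (k : ℝ) ≤ n + 2 := hka.trans <|
      (Real.rpow_le_rpow_of_exponent_le (by linarith) ha1.le).trans_eq (Real.rpow_one _)
    rw [div_le_iff₀ (by positivity)]
    nlinarith [mul_le_mul_of_nonneg_left hkle (by positivity : (0 : ℝ) ≤ k),
      mul_nonneg (mul_nonneg (by positivity : (0 : ℝ) ≤ k) (by positivity : (0 : ℝ) ≤ (n : ℝ) + 2))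
        (sub_nonneg.mpr hℓ1)]
  rw [show (1 - a) / 8 * (k * ℓ + (k : ℝ) ^ 2 / (n + 2)) / Δmax * (2 * Δmax) =
    (1 - a) / 4 * (k * ℓ + (k : ℝ) ^ 2 / (n + 2)) by field_simp; ring]
  have h1 : (1 - a) / 4 * (k * ℓ + (k : ℝ) ^ 2 / (n + 2)) ≤ (1 - a) / 4 * (k * ℓ + k * ℓ) := by
    gcongr
  have h2 : k * ((1 - a) * ℓ - Real.log 2) ≤ k * (Real.log n - Real.log k) := by
    exact mul_le_mul_of_nonneg_left (by linarith) (by positivity)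
  have h3 := mul_le_mul_of_nonneg_left hlogm (by positivity : (0 : ℝ) ≤ k)
  have h4 : Real.log 2 ≤ k * Real.log 2 := le_mul_of_one_le_left hlog2.le hk1
  linarith

theorem corollary2 :
    (∀ m : ℕ, IsNecessary.{u, v} (allDAGs m)
      (fun Δmax => Real.log 2 / Δmax * (((m : ℝ) - 3) / 2 - 1 / (m : ℝ)))) ∧
    (∀ m k : ℕ, 2 < m → k < m → IsNecessary.{u, v} (sparseDAGs m k)
      (fun Δmax => 1 / (2 * Δmax) *
        ((k : ℝ) * Real.log ((m : ℝ) - 2) + (k : ℝ) * ((k : ℝ) - 3) * Real.log 2 / (2 * (m : ℝ))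
          - remainder m k))) ∧
    (∃ c : ℝ, 0 < c ∧ ∃ m₀ : ℕ, ∀ m : ℕ, m₀ ≤ m →
      IsNecessary.{u, v} (allDAGs m) (fun Δmax => c * (m : ℝ) / Δmax)) ∧
    (∀ a : ℝ, 0 < a → a < 1 → ∃ c : ℝ, 0 < c ∧ ∃ m₀ : ℕ, ∀ m k : ℕ, m₀ ≤ m → 1 ≤ k →
      (k : ℝ) ≤ (m : ℝ) ^ a →
      IsNecessary.{u, v} (sparseDAGs m k)
        (fun Δmax => c * ((k : ℝ) * Real.log (m : ℝ) + (k : ℝ) ^ 2 / (m : ℝ)) / Δmax)) := by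
  exact ⟨isNecessary_allDAGs, fun m k hm hkm => isNecessary_sparseDAGs hm hkm,
    ⟨Real.log 2 / 6, by positivity, 12, fun m hm => isNecessary_allDAGs_linear hm⟩,
    fun a _ ha1 => exists_isNecessary_sparseDAGs ha1⟩
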